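/- **Conventions.** A $3$-graph $H$ consists of a finite vertex set $V(H)$ and a set $E(H)$ of $3$-element subsets of $V(H)$. It is tripartite, written $H=(U\cup V\cup W,F)$, if $V(H)$ is the disjoint union of $U,V,W$, $F=E(H)$, and every edge meets each of $U,V,W$ in at most one vertex. The slice graph $H_x$ at $x\in V(H)$ is the graph on $V(H)$ whose edges are the pairs $yz$ with $xyz\in E(H)$. The VC-dimension of a graph $G$ is the largest $d$ for which there are vertices $a_i$ $(i\in[d])$ and $b_S$ $(S\subseteq[d])$ of $G$ such that $a_ib_S\in E(G)$ if and only if $i\in S$; the slicewise VC-dimension of $H$ is the maximum of the VC-dimensions of the graphs $H_x$, $x\in V(H)$. Partitions are into nonempty parts, and the size of a partition is its number of parts. Let $\epsilon>0$. For nonempty $X,Y,Z\subseteq V(H)$ put $$d_H(X,Y,Z)=\frac{|\{(x,y,z)\in X\times Y\times Z:\ xyz\in E(H)\}|}{|X||Y||Z|},$$ and call $(X,Y,Z)$ $\epsilon$-homogeneous if $d_H(X,Y,Z)\in[0,\epsilon)\cup(1-\epsilon,1]$. A partition $\mathcal P$ of $V(H)$ is $\epsilon$-homogeneous with respect to $H$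 if at least $(1-\epsilon)|V(H)|^3$ of the triples $(x,y,z)\in V(H)^3$ lie in $X\times Y\times Z$ for some $\epsilon$-homogeneous $(X,Y,Z)\in\mathcal P^3$. Let $H$ be tripartite and let $A,B,C$ be its three parts in any order. A nonempty set $X\subseteq A$ is almost $\epsilon$-good with respect to $H$ if for at least $(1-\epsilon)|B||C|$ pairs $(y,z)\in B\times C$ one has $$\frac{|\{x\in X:\ xyz\in E(H)\}|}{|X|}\in[0,\epsilon)\cup(1-\epsilon,1].$$ A partition $\mathcal P$ of $A$ is almost $\epsilon$-good with respect to $H$ if there is $\mathcal P'\subseteq\mathcal P$ such that $\left|\bigcup_{X\in\mathcal P'}X\right|\ge(1-\epsilon)|A|$ and every $X\in\mathcal P'$ is almost $\epsilon$-good with respect to $H$. **Theorem 4.1.** For every integer $k\ge1$ there are real numbers $K,\epsilon^*>0$ such that for every real $\tau$ with $0<\tau<\epsilon^*$ there is an integer $n_0$ such that the following holds. Let $H=(U\cup V\cup W,F)$ be a tripartite $3$-graph with $|U|=|V|=|W|$, with $|V(H)|\ge n_0$, and with slicewise VC-dimension less than $k$. Then there exists a $\tau$-homogeneous partition $\mathcal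 P$ of $V(H)$ with respect to $H$ of size at most $2^{2^{\tau^{-K}}}$. Moreover, $\mathcal P$ can be chosen of the form $\mathcal P=\mathcal P_U\cup\mathcal P_V\cup\mathcal P_W$, where $\mathcal P_U,\mathcal P_V,\mathcal P_W$ are almost $(\tau^{64}/28)$-good partitions, with respect to $H$, of $U$, $V$, $W$ respectively. -/

import Mathlib

open scoped Hypergraph

namespace Hypergraph

variable {α : Type*}

/-- A `k`-uniform hypergraph: every edge is a set of exactly `k` vertices. For `k = 3` this is a
`3`-graph, for `k = 2` a graph. -/
def IsUniform (H : Hypergraph α) (k : ℕ) : Prop :=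
  ∀ e ∈ E(H), e.encard = k

/-- `H` is tripartite with parts `U`, `V`, `W`: the vertex set is the disjoint union of the three
finite sets `U`, `V`, `W`, and every edge meets each of them in at most one vertex. -/
structure IsTripartite (H : Hypergraph α) (U V W : Finset α) : Prop where
  vertexSet_eq : V(H) = (U : Set α) ∪ (V : Set α) ∪ (W : Set α)
  disjoint_left_mid : Disjoint U V
  disjoint_left_right : Disjoint U W
  disjoint_mid_right : Disjoint V W
  encard_inter_left_le : ∀ e ∈ E(H), (e ∩ (U : Set α)).encard ≤ 1
  encard_inter_mid_le : ∀ e ∈ E(H), (e ∩ (V : Set α)).encard ≤ 1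
  encard_inter_right_le : ∀ e ∈ E(H), (e ∩ (W : Set α)).encard ≤ 1

/-- The slice graph of `H` at `x`: its vertex set is the whole vertex set of `H`, its edges are the
pairs of vertices that together with `x` form an edge of `H`.  If `H` is a `3`-graph, no pair
containing `x` is an edge of the slice graph. -/
def sliceGraph (H : Hypergraph α) (x : α) : Hypergraph α where
  vertexSet := V(H)
  edgeSet := {e | e ⊆ V(H) ∧ e.encard = 2 ∧ insert x e ∈ E(H)}
  subset_vertexSet_of_mem_edgeSet' := fun _ he => he.1

/-- There are vertices `a i` (for `i ∈ [k]`) and `b S` (for `S ⊆ [k]`) of the graph `G` such that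
`{a i, b S}` is an edge of `G` if and only if `i ∈ S`. -/
def ShattersSize (G : Hypergraph α) (k : ℕ) : Prop :=
  ∃ (a : Fin k → α) (b : Finset (Fin k) → α),
    (∀ i, a i ∈ V(G)) ∧ (∀ S, b S ∈ V(G)) ∧ ∀ i S, ({a i, b S} : Set α) ∈ E(G) ↔ i ∈ S

/-- The VC-dimension of a graph: the largest `k` with `G.ShattersSize k` (and `⊤` if there are
arbitrarily large ones, which is impossible for finite `G`). -/
noncomputable def vcDim (G : Hypergraph α) : ℕ∞ :=
  ⨆ (k : ℕ) (_ : G.ShattersSize k), (k : ℕ∞)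

/-- The slicewise VC-dimension of `H`: the maximum of the VC-dimensions of its slice graphs. -/
noncomputable def slicewiseVCDim (H : Hypergraph α) : ℕ∞ :=
  ⨆ x ∈ V(H), (H.sliceGraph x).vcDim

/-- `d ∈ [0, ε) ∪ (1 - ε, 1]`. -/
def NearZeroOne (ε d : ℝ) : Prop :=
  d ∈ Set.Ico 0 ε ∪ Set.Ioc (1 - ε) 1

open Classical in
/-- The density of the triple `(X, Y, Z)` in the `3`-graph `H`: the proportion of
`(x, y, z) ∈ X × Y × Z` for which `{x, y, z}` is an edge. -/
noncomputable def density (H : Hypergraph α) (X Y Z : Finset α) : ℝ :=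
  (((X ×ˢ Y ×ˢ Z).filter fun p => ({p.1, p.2.1, p.2.2} : Set α) ∈ E(H)).card : ℝ) /
    ((X.card : ℝ) * (Y.card : ℝ) * (Z.card : ℝ))

/-- The triple `(X, Y, Z)` is `ε`-homogeneous with respect to `H`. -/
def IsHomogeneousTriple (H : Hypergraph α) (ε : ℝ) (X Y Z : Finset α) : Prop :=
  NearZeroOne ε (H.density X Y Z)

open Classical in
/-- The partition `P` of the (finite) vertex set `S` of the `3`-graph `H` is `ε`-homogeneous: at
least `(1 - ε)|S|³` of the ordered triples in `S³` lie in `X × Y × Z` for some `ε`-homogeneous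
triple `(X, Y, Z)` of parts. -/
def IsHomogeneousPartition [DecidableEq α] (H : Hypergraph α) (ε : ℝ) {S : Finset α}
    (P : Finpartition S) : Prop :=
  (1 - ε) * (S.card : ℝ) ^ 3 ≤
    (((S ×ˢ S ×ˢ S).filter fun p => ∃ X ∈ P.parts, ∃ Y ∈ P.parts, ∃ Z ∈ P.parts,
      H.IsHomogeneousTriple ε X Y Z ∧ p.1 ∈ X ∧ p.2.1 ∈ Y ∧ p.2.2 ∈ Z).card : ℝ)

open Classical in
/-- Let `A`, `B`, `C` be, in any order, the three parts of a tripartite `3`-graph `H`, and let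
`X ⊆ A`.  The set `X` is almost `ε`-good with respect to `H` if at least `(1 - ε)|B||C|` of the
pairs `(y, z) ∈ B × C` satisfy `|N_H(yz) ∩ X| / |X| ∈ [0, ε) ∪ (1 - ε, 1]`, where
`N_H(yz) = {x | {x, y, z} ∈ E(H)}`. -/
def IsAlmostGoodSet (H : Hypergraph α) (ε : ℝ) (B C X : Finset α) : Prop :=
  (1 - ε) * ((B.card : ℝ) * (C.card : ℝ)) ≤
    (((B ×ˢ C).filter fun p => NearZeroOne ε
      (((X.filter fun x => ({x, p.1, p.2} : Set α) ∈ E(H)).card : ℝ) / (X.card : ℝ))).card : ℝ)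

/-- Let `A`, `B`, `C` be, in any order, the three parts of a tripartite `3`-graph `H`.  A partition
`P` of `A` is almost `ε`-good with respect to `H` if there is a subcollection of parts that covers
at least `(1 - ε)|A|` vertices of `A` and all of whose members are almost `ε`-good sets. -/
def IsAlmostGoodPartition [DecidableEq α] (H : Hypergraph α) (ε : ℝ) (B C : Finset α)
    {A : Finset α} (P : Finpartition A) : Prop :=
  ∃ Q ⊆ P.parts, (1 - ε) * (A.card : ℝ) ≤ ((Q.biUnion id).card : ℝ) ∧
    ∀ X ∈ Q, H.IsAlmostGoodSet ε B C X

end Hypergraph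

/-! ### Bounded shattering gives polynomially many traces -/

section Shattering

open Finset

/-! The goal is to partition each part, say `U`, so that for most pairs `(v, w)` the link of `vw` is
nearly constant on most cells; quantitatively, so that the sum of `minorityCount` over cells and
pairs is small.

For fixed `w`, Sauer–Shelah gives only polynomially many traces of the neighbourhoods `N_w(u)` on a
set `A ⊆ V`, so the entropy of the trace partitions of `U`, averaged over `w`, is logarithmic in
`|A|`. While some `v` is badly predicted from the traces by majority vote, adding `v` to `A` raises
the entropy by a fixed amount. Hence a small `A` predicts every `v` (`exists_traceOn_approx`). These
traces still depend on `w`; applying the same argument to each `a ∈ A`, with `V` and `W` exchanged,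
encodes the bits `f u a w` by a small set `B a ⊆ W`. The pattern of `u` on the pairs `(a, b)` with
`b ∈ B a` is then a colour independent of `v` and `w`, and the colour classes are the cells
(`exists_coloring_approx`).

Almost goodness follows by applying Markov's inequality twice. For homogeneity, a box of cells with
many edges and many non-edges contains many edge/non-edge pairs; changing one coordinate at a time,
each such pair yields a disagreement along some axis, and these are paid for by minority counts
(`card_filter_isEdge_mul_le`). -/

/-- The polynomial form of the Sauer–Shelah lemma: a family of subsets of `A` that shatters no set
of size `k` has at most `(|A| + 1) ^ k` members. -/
theorem Finset.card_le_of_not_shatters {β : Type*} [DecidableEq β] {k : ℕ} {A : Finset β}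
    {𝒜 : Finset (Finset β)} (hA : ∀ s ∈ 𝒜, s ⊆ A)
    (h : ∀ s ⊆ A, #s = k → ¬ 𝒜.Shatters s) : #𝒜 ≤ (#A + 1) ^ k := by
  have hsub : 𝒜.shatterer ⊆ (range k).biUnion fun i => A.powersetCard i := by
    intro s hs
    rw [mem_shatterer] at hs
    obtain ⟨t, ht, hst⟩ := hs.exists_superset
    have hsA : s ⊆ A := hst.trans (hA t ht)
    simp only [mem_biUnion, mem_range, mem_powersetCard]
    refine ⟨#s, ?_, hsA, rfl⟩
    by_contra! hk
    obtain ⟨r, hrs, hr⟩ := exists_subset_card_eq hk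
    exact h r (hrs.trans hsA) hr (hs.mono_right hrs)
  calc #𝒜 ≤ #𝒜.shatterer := card_le_card_shatterer _
    _ ≤ ∑ i ∈ range k, #(A.powersetCard i) := (card_le_card hsub).trans card_biUnion_le
    _ ≤ ∑ i ∈ range (k + 1), #A ^ i * 1 ^ (k - i) * k.choose i := by
        rw [sum_range_succ]
        refine le_add_right (sum_le_sum fun i hi => ?_)
        rw [card_powersetCard, one_pow, mul_one]
        calc (#A).choose i ≤ #A ^ i := Nat.choose_le_pow _ _
          _ ≤ #A ^ i * k.choose i :=
            Nat.le_mul_of_pos_right _ (Nat.choose_pos (mem_range.1 hi).le)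
    _ = (#A + 1) ^ k := (add_pow _ _ _).symm

end Shattering

/-! ### Entropy increment: a small set whose traces predict every `v` -/

section Greedy

open Finset Classical

variable {β γ δ : Type*}

/-- The trace of `N_w(u) = {v | f u v w}` on `A`. -/
noncomputable def traceOn (f : β → γ → δ → Prop) (A : Finset γ) (w : δ) (u : β) : Finset γ :=
  A.filter fun v => f u v w

/-- The elements of `U` with the same trace as `u`. -/
noncomputable def traceClass (f : β → γ → δ → Prop) (U : Finset β) (A : Finset γ) (w : δ) (u : β) :
    Finset β :=
  U.filter fun u' => traceOn f A w u' = traceOn f A w u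

/-- The total entropy, over all `w ∈ W`, of the partitions of `U` into trace classes. -/
noncomputable def traceEntropy (f : β → γ → δ → Prop) (U : Finset β) (W : Finset δ)
    (A : Finset γ) : ℝ :=
  ∑ w ∈ W, ∑ u ∈ U, Real.log (#U / #(traceClass f U A w u))

theorem traceClass_pos {f : β → γ → δ → Prop} {U : Finset β} {A : Finset γ} {w : δ} {u : β}
    (hu : u ∈ U) : (0 : ℝ) < #(traceClass f U A w u) := by
  have : u ∈ traceClass f U A w u := by simp [traceClass, hu]
  exact_mod_cast card_pos.2 ⟨u, this⟩

theorem traceClass_insert (f : β → γ → δ → Prop) (U : Finset β) (A : Finset γ) (v : γ) (w : δ)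
    (u : β) : traceClass f U (insert v A) w u =
      (traceClass f U A w u).filter fun u' => f u' v w ↔ f u v w := by
  ext u'
  simp only [traceClass, mem_filter, and_assoc, and_congr_right_iff]
  intro _
  simp only [traceOn, Finset.ext_iff, mem_filter, mem_insert]
  constructor
  · intro h
    refine ⟨fun a => ?_, ?_⟩
    · have := h a
      by_cases ha : a ∈ A <;> simp_all
    · simpa using h v
  · rintro ⟨h, hv⟩ a
    have := h a
    by_cases hav : a = v
    · subst hav; simp [hv]
    · simp_all

/-- The majority vote, among the elements of `U` with trace `T`, on whether `f · v w` holds. -/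
def majority (f : β → γ → δ → Prop) (U : Finset β) (A : Finset γ) (v : γ) (w : δ)
    (T : Finset γ) : Prop :=
  #(U.filter fun u => traceOn f A w u = T) ≤
    2 * #((U.filter fun u => traceOn f A w u = T).filter fun u => f u v w)

/-- Outvoted elements make up at most half of their class, and after inserting `v` the class of `u`
keeps only those who vote like `u`. -/
theorem two_mul_card_traceClass_insert_le {f : β → γ → δ → Prop} {U : Finset β} {A : Finset γ}
    {v : γ} {w : δ} {u : β} (h : ¬ (f u v w ↔ majority f U A v w (traceOn f A w u))) :
    2 * #(traceClass f U (insert v A) w u) ≤ #(traceClass f U A w u) := by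
  rw [traceClass_insert]
  change ¬ (f u v w ↔ #(traceClass f U A w u) ≤
    2 * #((traceClass f U A w u).filter fun u => f u v w)) at h
  by_cases hf : f u v w
  · simp only [hf, iff_true, true_iff] at h ⊢
    omega
  · simp only [hf, iff_false, false_iff, not_not] at h ⊢
    have := card_filter_add_card_filter_not (s := traceClass f U A w u) (fun u => f u v w)
    omega

/-- Each outvoted pair `(u, w)` has its class at least halved and so gains `log 2`; no other pair
loses, since classes only shrink. -/
theorem traceEntropy_insert (f : β → γ → δ → Prop) (U : Finset β) (W : Finset δ) (A : Finset γ)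
    (v : γ) : traceEntropy f U W A + Real.log 2 * ∑ w ∈ W, (#(U.filter fun u =>
      ¬ (f u v w ↔ majority f U A v w (traceOn f A w u))) : ℝ) ≤
      traceEntropy f U W (insert v A) := by
  unfold traceEntropy
  rw [mul_sum, ← sum_add_distrib]
  refine sum_le_sum fun w _ => ?_
  rw [card_filter, Nat.cast_sum, mul_sum, ← sum_add_distrib]
  refine sum_le_sum fun u hu => ?_
  have hU : (0 : ℝ) < #U := by exact_mod_cast card_pos.2 ⟨u, hu⟩
  have h1 := traceClass_pos (f := f) (A := A) (w := w) hu
  have h2 := traceClass_pos (f := f) (A := insert v A) (w := w) hu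
  by_cases h : ¬ (f u v w ↔ majority f U A v w (traceOn f A w u))
  · rw [if_pos h]
    have h3 : (2 : ℝ) * #(traceClass f U (insert v A) w u) ≤ #(traceClass f U A w u) := by
      exact_mod_cast two_mul_card_traceClass_insert_le h
    rw [Nat.cast_one, mul_one, ← Real.log_mul (by positivity) (by positivity)]
    refine Real.log_le_log (by positivity) ?_
    rw [div_mul_eq_mul_div, div_le_div_iff₀ h1 h2]
    nlinarith
  · rw [if_neg h]
    have h3 : (#(traceClass f U (insert v A) w u) : ℝ) ≤ #(traceClass f U A w u) := by
      rw [traceClass_insert]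
      exact_mod_cast card_le_card (filter_subset _ _)
    simp only [Nat.cast_zero, mul_zero, add_zero]
    refine Real.log_le_log (by positivity) ?_
    gcongr

/-- A class of size `m` contributes `m` terms `1 / m`, so the sum counts the classes. -/
theorem sum_inv_card_traceClass (f : β → γ → δ → Prop) (U : Finset β) (A : Finset γ) (w : δ) :
    ∑ u ∈ U, (#(traceClass f U A w u) : ℝ)⁻¹ = #(U.image (traceOn f A w)) := by
  rw [← sum_fiberwise_of_maps_to (g := traceOn f A w) (t := U.image (traceOn f A w))
    (fun u hu => mem_image_of_mem _ hu), card_eq_sum_ones, Nat.cast_sum]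
  refine sum_congr rfl fun T hT => ?_
  obtain ⟨u, hu, rfl⟩ := mem_image.1 hT
  have : ∀ u' ∈ U.filter (fun u' => traceOn f A w u' = traceOn f A w u),
      (#(traceClass f U A w u') : ℝ)⁻¹ = (#(traceClass f U A w u) : ℝ)⁻¹ := by
    intro u' hu'
    simp only [traceClass, (mem_filter.1 hu').2]
  rw [sum_congr rfl this, sum_const, nsmul_eq_mul, Nat.cast_one]
  exact mul_inv_cancel₀ (traceClass_pos hu).ne'

/-- Entropy is at most the logarithm of the number of classes. Instead of Jensen, `log t ≤ t - 1` is
used at `t = |U| / (N |class|)`. -/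
theorem traceEntropy_le {f : β → γ → δ → Prop} {U : Finset β} {W : Finset δ} {A : Finset γ}
    {N : ℕ} (hN : 0 < N) (h : ∀ w ∈ W, #(U.image (traceOn f A w)) ≤ N) :
    traceEntropy f U W A ≤ #W * (#U * Real.log N) := by
  unfold traceEntropy
  rw [← nsmul_eq_mul]
  refine sum_le_card_nsmul _ _ _ fun w hw => ?_
  have hN' : (0 : ℝ) < N := by exact_mod_cast hN
  have key : ∀ u ∈ U, Real.log (#U / #(traceClass f U A w u)) ≤
      #U / N * (#(traceClass f U A w u) : ℝ)⁻¹ - 1 + Real.log N := by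
    intro u hu
    have hU : (0 : ℝ) < #U := by exact_mod_cast card_pos.2 ⟨u, hu⟩
    have h1 := traceClass_pos (f := f) (A := A) (w := w) hu
    have h2 : (0 : ℝ) < #U / N * (#(traceClass f U A w u) : ℝ)⁻¹ := by positivity
    have h3 := Real.log_le_sub_one_of_pos h2
    have h4 : (#U : ℝ) / #(traceClass f U A w u) =
        #U / N * (#(traceClass f U A w u) : ℝ)⁻¹ * N := by field_simp
    rw [h4, Real.log_mul h2.ne' hN'.ne']
    linarith
  refine (sum_le_sum key).trans ?_
  rw [sum_add_distrib, sum_sub_distrib, ← mul_sum, sum_inv_card_traceClass, sum_const, sum_const,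
    nsmul_eq_mul, nsmul_eq_mul, mul_one]
  have h5 : (#(U.image (traceOn f A w)) : ℝ) ≤ N := by exact_mod_cast h w hw
  have h6 : (#U : ℝ) / N * #(U.image (traceOn f A w)) ≤ #U := by
    calc (#U : ℝ) / N * #(U.image (traceOn f A w)) ≤ #U / N * N := by gcongr
      _ = #U := by field_simp
  linarith

/-- If the sets `N_w(u) = {v | f u v w}` have few traces on small sets, then there is a small set
`A` such that for every `v` the value of `f u v w` is for most pairs `(u, w)` determined by `w` and
the trace of `N_w(u)` on `A`. -/
theorem exists_traceOn_approx {f : β → γ → δ → Prop} {U : Finset β} {V : Finset γ} {W : Finset δ}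
    {k r : ℕ} {ε : ℝ} (hk : 1 ≤ k) (hr : 4 * k ≤ r * ε)
    (h : ∀ w ∈ W, ∀ A ⊆ V, #(U.image (traceOn f A w)) ≤ (#A + 1) ^ k) :
    ∃ A ⊆ V, #A ≤ r ^ 2 ∧ ∀ v ∈ V, ∃ g : δ → Finset γ → Prop,
      ∑ w ∈ W, (#(U.filter fun u => ¬ (f u v w ↔ g w (traceOn f A w u))) : ℝ) ≤
        ε * (#U * #W) := by
  by_contra hcon
  simp only [not_exists, not_and, not_forall, not_le] at hcon
  have hk' : (1 : ℝ) ≤ k := by exact_mod_cast hk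
  -- If no `A` works, the greedy insertion can be run for `r ^ 2` rounds, each gaining at least `log
  -- 2 * ε|U||W|`.
  have step : ∀ n ≤ r ^ 2, ∃ A ⊆ V, #A ≤ n ∧
      n * (Real.log 2 * (ε * (#U * #W))) ≤ traceEntropy f U W A := by
    intro n
    induction n with
    | zero =>
      intro _
      refine ⟨∅, empty_subset _, by simp, ?_⟩
      rw [Nat.cast_zero, zero_mul]
      refine sum_nonneg fun w _ => sum_nonneg fun u hu => Real.log_nonneg ?_
      rw [one_le_div (traceClass_pos hu)]
      exact_mod_cast card_le_card (filter_subset _ _)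
    | succ n ih =>
      intro hn
      obtain ⟨A, hAV, hA, hent⟩ := ih (by omega)
      obtain ⟨v, hv, hg⟩ := hcon A hAV (by omega)
      refine ⟨insert v A, insert_subset hv hAV, (card_insert_le _ _).trans (by omega), ?_⟩
      have h1 := traceEntropy_insert f U W A v
      have h2 := mul_le_mul_of_nonneg_left (hg (majority f U A v)).le
        (Real.log_nonneg one_le_two)
      push_cast
      linarith
  obtain ⟨A, hAV, hA, hent⟩ := step _ le_rfl
  have h1 := traceEntropy_le (f := f) (U := U) (W := W) (A := A)
    (N := (#A + 1) ^ k) (by positivity) (fun w hw => h w hw A hAV)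
  obtain ⟨v, hv, hg⟩ := hcon A hAV hA
  have hpos : 0 < (#U : ℝ) * #W := by
    by_contra hle
    have h0 : (#U : ℝ) * #W = 0 := le_antisymm (not_lt.1 hle) (by positivity)
    have := hg fun _ _ => True
    rw [h0, mul_zero] at this
    rcases mul_eq_zero.1 h0 with h0 | h0
    · have : U = ∅ := by simpa using h0
      simp_all
    · have : W = ∅ := by simpa using h0
      simp_all
  have hr0 : (0 : ℝ) < r := by
    by_contra hle
    have : (r : ℝ) = 0 := le_antisymm (not_lt.1 hle) (by positivity)
    rw [this] at hr
    linarith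
  -- The crude bound `log (r + 1) ≤ r` suffices: entropy grows like `r ^ 2 * ε` but is capped
  -- linearly in `r`. With `r * ε ≥ 4k`, the contradiction is `log 2 > 1 / 2`.
  have h2 : Real.log ((((#A + 1) ^ k : ℕ)) : ℝ) ≤ k * (2 * r) := by
    push_cast
    rw [Real.log_pow]
    gcongr
    have h3 : ((#A : ℝ) + 1) ≤ (r + 1) ^ 2 := by
      have : (#A : ℝ) ≤ r ^ 2 := by exact_mod_cast hA
      nlinarith
    calc Real.log (#A + 1) ≤ Real.log ((r + 1) ^ 2) := Real.log_le_log (by positivity) h3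
      _ = 2 * Real.log (r + 1) := by rw [Real.log_pow]; norm_num
      _ ≤ 2 * r := by
        have := Real.log_le_sub_one_of_pos (x := (r : ℝ) + 1) (by positivity)
        linarith
  have h4 : (r : ℝ) ^ 2 * (Real.log 2 * (ε * (#U * #W))) ≤ #W * (#U * (k * (2 * r))) := by
    calc (r : ℝ) ^ 2 * (Real.log 2 * (ε * (#U * #W))) ≤ _ := by exact_mod_cast hent
      _ ≤ _ := h1
      _ ≤ _ := by gcongr
  have h5 : (r : ℝ) * (#U * #W) * (r * ε * Real.log 2) ≤ r * (#U * #W) * (2 * k) := by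
    nlinarith [h4]
  have h6 := le_of_mul_le_mul_left h5 (by positivity)
  have h7 := Real.log_two_gt_d9
  nlinarith

end Greedy

/-! ### Colouring `U` independently of `v` and `w` -/

section Partition

open Finset Classical

variable {β γ δ : Type*}

/-- If both the sets `N_w(u) = {v | f u v w}` and the sets `N_v(u) = {w | f u v w}` have few traces
on small sets, then for every `v` the value of `f u v w` is for most pairs `(u, w)` determined by
`w` and a colour of `u` that depends neither on `v` nor on `w`. -/
theorem exists_coloring_approx {f : β → γ → δ → Prop} {U : Finset β} {V : Finset γ} {W : Finset δ}
    {k r q : ℕ} {ε₁ ε₂ : ℝ} (hk : 1 ≤ k) (hr : 4 * k ≤ r * ε₁) (hq : 4 * k ≤ q * ε₂)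
    (hrε : r ^ 2 * ε₂ ≤ ε₁)
    (h₁ : ∀ w ∈ W, ∀ A ⊆ V, #(U.image (traceOn f A w)) ≤ (#A + 1) ^ k)
    (h₂ : ∀ v ∈ V, ∀ B ⊆ W, #(U.image (traceOn (fun u w v => f u v w) B v)) ≤ (#B + 1) ^ k) :
    ∃ c : β → Finset (Σ _ : γ, δ), #(U.image c) ≤ 2 ^ (r ^ 2 * q ^ 2) ∧
      ∀ v ∈ V, ∃ g : δ → Finset (Σ _ : γ, δ) → Prop,
        ∑ w ∈ W, (#(U.filter fun u => ¬ (f u v w ↔ g w (c u))) : ℝ) ≤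
          2 * ε₁ * (#U * #W) := by
  obtain ⟨A, hAV, hA, hg⟩ := exists_traceOn_approx hk hr h₁
  have hB : ∀ a ∈ A, ∃ B ⊆ W, #B ≤ q ^ 2 ∧ ∀ w ∈ W, ∃ g : Finset δ → Prop,
      (#(U.filter fun u => ¬ (f u a w ↔ g (traceOn (fun u w v => f u v w) B a u))) : ℝ) ≤
        ε₂ * #U := by
    intro a ha
    -- With the singleton `{a}` in the third slot, the averaged error becomes a bound for this
    -- particular `a`.
    obtain ⟨B, hBW, hB, hg⟩ := exists_traceOn_approx (f := fun u w v => f u v w) (U := U) (V := W)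
      (W := {a}) hk hq (fun v hv => by rw [mem_singleton.1 hv]; exact h₂ a (hAV ha))
    refine ⟨B, hBW, hB, fun w hw => ?_⟩
    obtain ⟨g, hg⟩ := hg w hw
    exact ⟨g a, by simpa using hg⟩
  choose! B hBW hB G hG using hB
  have hε₂ : 0 ≤ ε₂ := by
    have : (1 : ℝ) ≤ k := by exact_mod_cast hk
    by_contra! hneg
    have : (q : ℝ) * ε₂ ≤ 0 := mul_nonpos_of_nonneg_of_nonpos (by positivity) hneg.le
    linarith
  refine ⟨fun u => (A.sigma B).filter fun p => f u p.1 p.2, ?_, fun v hv => ?_⟩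
  · calc _ ≤ #(A.sigma B).powerset :=
          card_le_card (image_subset_iff.2 fun u _ => mem_powerset.2 (filter_subset _ _))
      _ = 2 ^ #(A.sigma B) := card_powerset _
      _ ≤ 2 ^ (r ^ 2 * q ^ 2) := by
        refine Nat.pow_le_pow_right two_pos ?_
        rw [card_sigma]
        calc _ ≤ #A • q ^ 2 := sum_le_card_nsmul _ _ _ hB
          _ ≤ r ^ 2 * q ^ 2 := by rw [smul_eq_mul]; gcongr
  obtain ⟨g, hg⟩ := hg v hv
  -- Two-stage decoding: the colour gives the trace on each `B a`, hence a guess for every bit `f u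
  -- a w`, hence a guessed trace on `A`, to which `g` is applied. It can fail only if `g` fails or
  -- one of the at most `r ^ 2` guessed bits is wrong.
  refine ⟨fun w C => g w (A.filter fun a => G a w ((B a).filter fun b => ⟨a, b⟩ ∈ C)), ?_⟩
  have key : ∀ w ∈ W, (#(U.filter fun u => ¬ (f u v w ↔ g w (A.filter fun a => G a w
      ((B a).filter fun b => (⟨a, b⟩ : Σ _ : γ, δ) ∈
        (A.sigma B).filter fun p => f u p.1 p.2)))) : ℝ) ≤
      #(U.filter fun u => ¬ (f u v w ↔ g w (traceOn f A w u))) + ε₁ * #U := by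
    intro w hw
    have hsub : (U.filter fun u => ¬ (f u v w ↔ g w (A.filter fun a => G a w
        ((B a).filter fun b => (⟨a, b⟩ : Σ _ : γ, δ) ∈
          (A.sigma B).filter fun p => f u p.1 p.2)))) ⊆
        (U.filter fun u => ¬ (f u v w ↔ g w (traceOn f A w u))) ∪
          A.biUnion fun a => U.filter fun u =>
            ¬ (f u a w ↔ G a w (traceOn (fun u w v => f u v w) (B a) a u)) := by
      intro u hu
      rw [mem_filter] at hu
      by_contra hnot
      simp only [mem_union, mem_biUnion, mem_filter, not_or, not_exists, not_and, not_not] at hnot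
      apply hu.2
      rw [hnot.1 hu.1]
      have : (A.filter fun a => G a w ((B a).filter fun b => (⟨a, b⟩ : Σ _ : γ, δ) ∈
          (A.sigma B).filter fun p => f u p.1 p.2)) = traceOn f A w u := by
        refine filter_congr fun a ha => ?_
        rw [hnot.2 a ha hu.1]
        have : ((B a).filter fun b => (⟨a, b⟩ : Σ _ : γ, δ) ∈
            (A.sigma B).filter fun p => f u p.1 p.2) =
            traceOn (fun u w v => f u v w) (B a) a u :=
          filter_congr fun b hb => by simp [ha, hb]
        rw [this]
      rw [this]
    calc _ ≤ ((#(U.filter fun u => ¬ (f u v w ↔ g w (traceOn f A w u))) +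
          ∑ a ∈ A, #(U.filter fun u =>
            ¬ (f u a w ↔ G a w (traceOn (fun u w v => f u v w) (B a) a u))) : ℕ) : ℝ) := by
          exact_mod_cast ((card_le_card hsub).trans (card_union_le _ _)).trans
            (Nat.add_le_add_left card_biUnion_le _)
      _ ≤ #(U.filter fun u => ¬ (f u v w ↔ g w (traceOn f A w u))) + #A • (ε₂ * #U) := by
          rw [Nat.cast_add, Nat.cast_sum]
          gcongr
          exact sum_le_card_nsmul _ _ _ fun a ha => hG a ha w hw
      _ ≤ _ := by
          rw [nsmul_eq_mul, ← mul_assoc]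
          have : (#A : ℝ) ≤ r ^ 2 := by exact_mod_cast hA
          gcongr
          calc (#A : ℝ) * ε₂ ≤ r ^ 2 * ε₂ := by gcongr
            _ ≤ ε₁ := hrε
  calc _ ≤ ∑ w ∈ W, ((#(U.filter fun u => ¬ (f u v w ↔ g w (traceOn f A w u))) : ℝ) +
        ε₁ * #U) := sum_le_sum key
    _ ≤ ε₁ * (#U * #W) + #W * (ε₁ * #U) := by
        rw [sum_add_distrib, sum_const, nsmul_eq_mul]
        gcongr
    _ = _ := by ring

/-- The smaller of the numbers of `x ∈ X` for which `f x v w` holds, respectively fails. -/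
noncomputable def minorityCount (f : β → γ → δ → Prop) (X : Finset β) (v : γ) (w : δ) : ℕ :=
  min #(X.filter fun x => f x v w) #(X.filter fun x => ¬ f x v w)

theorem minorityCount_le (f : β → γ → δ → Prop) (X : Finset β) (v : γ) (w : δ) (p : Prop) :
    minorityCount f X v w ≤ #(X.filter fun x => ¬ (f x v w ↔ p)) := by
  by_cases hp : p
  · simp only [hp, iff_true]
    exact Nat.min_le_right _ _
  · simp only [hp, iff_false, not_not]
    exact Nat.min_le_left _ _

/-- On a colour class the prediction is constant, so the minority is no larger than the number of
prediction errors there; these errors add up over disjoint classes. -/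
theorem exists_finpartition_minorityCount_le [DecidableEq β] {f : β → γ → δ → Prop} {U : Finset β}
    {V : Finset γ} {W : Finset δ} {k r q : ℕ} {ε₁ ε₂ : ℝ} (hk : 1 ≤ k) (hr : 4 * k ≤ r * ε₁)
    (hq : 4 * k ≤ q * ε₂) (hrε : r ^ 2 * ε₂ ≤ ε₁)
    (h₁ : ∀ w ∈ W, ∀ A ⊆ V, #(U.image (traceOn f A w)) ≤ (#A + 1) ^ k)
    (h₂ : ∀ v ∈ V, ∀ B ⊆ W, #(U.image (traceOn (fun u w v => f u v w) B v)) ≤ (#B + 1) ^ k) :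
    ∃ P : Finpartition U, #P.parts ≤ 2 ^ (r ^ 2 * q ^ 2) ∧
      ∑ X ∈ P.parts, ∑ v ∈ V, ∑ w ∈ W, (minorityCount f X v w : ℝ) ≤
        2 * ε₁ * (#U * #V * #W) := by
  obtain ⟨c, hc, hg⟩ := exists_coloring_approx hk hr hq hrε h₁ h₂
  let P := Finpartition.ofSetSetoid (Setoid.ker c) U
  have hP : ∀ X ∈ P.parts, ∃ C, X = U.filter fun u => c u = C := by
    intro X hX
    obtain ⟨a, -, rfl⟩ := mem_image.1 hX
    exact ⟨c a, filter_congr fun b _ => eq_comm⟩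
  refine ⟨P, ?_, ?_⟩
  · refine le_trans (card_le_card_of_surjOn (fun C => U.filter fun u => c u = C) ?_) hc
    intro X hX
    obtain ⟨a, ha, rfl⟩ := mem_image.1 hX
    refine ⟨c a, mem_coe.2 (mem_image_of_mem _ ha), ?_⟩
    exact filter_congr fun b _ => eq_comm
  · rw [sum_comm]
    have : ∀ v ∈ V, ∑ X ∈ P.parts, ∑ w ∈ W, (minorityCount f X v w : ℝ) ≤
        2 * ε₁ * (#U * #W) := by
      intro v hv
      obtain ⟨g, hg⟩ := hg v hv
      refine le_trans ?_ hg
      rw [sum_comm]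
      refine sum_le_sum fun w _ => ?_
      have h : ∀ X ∈ P.parts, minorityCount f X v w ≤
          #((U.filter fun u => ¬ (f u v w ↔ g w (c u))) ∩ X) := by
        intro X hX
        obtain ⟨C, rfl⟩ := hP X hX
        refine (minorityCount_le f _ v w (g w C)).trans (card_le_card fun x hx => ?_)
        simp only [mem_filter, mem_inter] at hx ⊢
        obtain ⟨⟨hxU, rfl⟩, hx⟩ := hx
        exact ⟨⟨hxU, hx⟩, hxU, rfl⟩
      rw [← Nat.cast_sum]
      refine Nat.cast_le.2 ((sum_le_sum h).trans ?_)
      rw [← card_biUnion]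
      · exact card_le_card (biUnion_subset.2 fun X _ => inter_subset_left)
      · intro X hX Y hY hXY
        exact (P.disjoint hX hY hXY).mono inter_subset_right inter_subset_right
    calc _ ≤ #V • (2 * ε₁ * (#U * #W)) := sum_le_card_nsmul _ _ _ this
      _ = _ := by rw [nsmul_eq_mul]; ring

end Partition

/-! ### From minority counts to almost good and homogeneous partitions -/

namespace Hypergraph

open Finset Classical

variable {α : Type*} {H : Hypergraph α}

/-- The vertices `x`, `y`, `z` form an edge. -/
def IsEdge (H : Hypergraph α) (x y z : α) : Prop := ({x, y, z} : Set α) ∈ E(H)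

theorem isEdge_swap_right (x y z : α) : H.IsEdge x y z ↔ H.IsEdge x z y := by
  rw [IsEdge, IsEdge, Set.pair_comm]

theorem isEdge_swap_left (x y z : α) : H.IsEdge x y z ↔ H.IsEdge y x z := by
  rw [IsEdge, IsEdge, Set.insert_comm]

theorem isEdge_rotate (x y z : α) : H.IsEdge x y z ↔ H.IsEdge z x y := by
  rw [isEdge_swap_right, isEdge_swap_left]

/-- A `k`-set shattered by the traces is shattered in the slice graph at `w`. Disjointness of `X`
and `Y` makes the pairs genuine two-element edges. -/
theorem card_image_traceOn_le {k : ℕ} (hk : H.slicewiseVCDim < (k : ℕ∞)) {X Y : Finset α}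
    (hXY : Disjoint X Y) (hX : (X : Set α) ⊆ V(H)) (hY : (Y : Set α) ⊆ V(H)) {w : α}
    (hw : w ∈ V(H)) {A : Finset α} (hA : A ⊆ Y) :
    #(X.image (traceOn H.IsEdge A w)) ≤ (#A + 1) ^ k := by
  refine card_le_of_not_shatters (fun s hs => ?_) fun s hsA hs hsh => ?_
  · obtain ⟨u, -, rfl⟩ := mem_image.1 hs
    exact filter_subset _ _
  refine hk.not_ge ?_
  have hsize : (H.sliceGraph w).ShattersSize k := by
    let e := (s.equivFinOfCardEq hs).symm
    have hb : ∀ S : Finset (Fin k), ∃ u ∈ X, s ∩ traceOn H.IsEdge A w u =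
        S.image fun i => (e i : α) := by
      intro S
      have hS : (S.image fun i => (e i : α)) ⊆ s := image_subset_iff.2 fun i _ => (e i).2
      obtain ⟨t, ht, hst⟩ := hsh hS
      obtain ⟨u, hu, rfl⟩ := mem_image.1 ht
      exact ⟨u, hu, hst⟩
    choose b hbX hb using hb
    have ha : ∀ i, (e i : α) ∈ Y := fun i => hA (hsA (e i).2)
    refine ⟨fun i => e i, b, fun i => hY (ha i), fun S => hX (hbX S), fun i S => ?_⟩
    have hne : (e i : α) ≠ b S := fun h => disjoint_left.1 hXY (hbX S) (h ▸ ha i)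
    have h1 : ({(e i : α), b S} : Set α) ∈ E(H.sliceGraph w) ↔ H.IsEdge (b S) (e i) w := by
      rw [isEdge_rotate, isEdge_swap_right]
      refine ⟨fun h => h.2.2, fun h => ⟨?_, Set.encard_pair hne, h⟩⟩
      exact Set.pair_subset (hY (ha i)) (hX (hbX S))
    have h2 : H.IsEdge (b S) (e i) w ↔ (e i : α) ∈ s ∩ traceOn H.IsEdge A w (b S) := by
      simp [traceOn, hsA (e i).2]
    rw [h1, h2, hb S, mem_image]
    refine ⟨fun ⟨j, hj, hji⟩ => ?_, fun h => ⟨i, h, rfl⟩⟩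
    rwa [← e.injective (Subtype.ext hji)]
  calc (k : ℕ∞) ≤ (H.sliceGraph w).vcDim :=
        le_iSup₂ (f := fun (k : ℕ) (_ : (H.sliceGraph w).ShattersSize k) => (k : ℕ∞)) k hsize
    _ ≤ H.slicewiseVCDim := le_iSup₂ (f := fun x (_ : x ∈ V(H)) => (H.sliceGraph x).vcDim) w hw

/-! ### Almost good partitions -/

theorem not_nearZeroOne_div {ε : ℝ} {a b n : ℕ} (hn : 0 < n) (hab : a + b = n)
    (h : ¬ NearZeroOne ε ((a : ℝ) / n)) : ε * n ≤ a ∧ ε * n ≤ b := by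
  have hn' : (0 : ℝ) < n := by exact_mod_cast hn
  have hab' : (a : ℝ) + b = n := by exact_mod_cast hab
  have h0 : (0 : ℝ) ≤ a / n := by positivity
  have h1 : (a : ℝ) / n ≤ 1 := by
    rw [div_le_one hn']
    have : (0 : ℝ) ≤ b := by positivity
    linarith
  simp only [NearZeroOne, Set.mem_union, Set.mem_Ico, Set.mem_Ioc, not_or, not_and, not_lt] at h
  have h2 := h.1 h0
  have h3 : (a : ℝ) / n ≤ 1 - ε := by
    by_contra! hlt
    exact h.2 hlt h1
  rw [le_div_iff₀ hn'] at h2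
  rw [div_le_iff₀ hn'] at h3
  exact ⟨h2, by linarith⟩

/-- Markov's inequality: a pair violating the density condition has minority count at least `ε|X|`.
-/
theorem isAlmostGoodSet_of_minorityCount_le {ε : ℝ} (hε : 0 < ε) {B C X : Finset α}
    (hX : X.Nonempty) (h : ∑ y ∈ B, ∑ z ∈ C, (minorityCount H.IsEdge X y z : ℝ) ≤
      ε ^ 2 * (#X * (#B * #C))) : H.IsAlmostGoodSet ε B C X := by
  unfold IsAlmostGoodSet
  have hX' : (0 : ℝ) < #X := by exact_mod_cast hX.card_pos
  set p : α × α → Prop := fun p => NearZeroOne ε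
    (((X.filter fun x => ({x, p.1, p.2} : Set α) ∈ E(H)).card : ℝ) / (X.card : ℝ)) with hp
  have hsplit : (#((B ×ˢ C).filter p) : ℝ) + #((B ×ˢ C).filter fun q => ¬ p q) = #B * #C := by
    rw [← Nat.cast_mul, ← card_product]
    exact_mod_cast card_filter_add_card_filter_not (s := B ×ˢ C) p
  have hbad : ∀ q ∈ (B ×ˢ C).filter fun q => ¬ p q,
      ε * #X ≤ minorityCount H.IsEdge X q.1 q.2 := by
    intro q hq
    have := not_nearZeroOne_div hX.card_pos
      (card_filter_add_card_filter_not (s := X) fun x => H.IsEdge x q.1 q.2) (mem_filter.1 hq).2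
    rw [minorityCount, Nat.cast_min]
    exact le_min this.1 this.2
  have h1 : #((B ×ˢ C).filter fun q => ¬ p q) • (ε * #X) ≤
      ∑ q ∈ B ×ˢ C, (minorityCount H.IsEdge X q.1 q.2 : ℝ) :=
    (card_nsmul_le_sum _ _ _ hbad).trans
      (sum_le_sum_of_subset_of_nonneg (filter_subset _ _) fun _ _ _ => Nat.cast_nonneg _)
  rw [sum_product, nsmul_eq_mul] at h1
  have h2 : (#((B ×ˢ C).filter fun q => ¬ p q) : ℝ) ≤ ε * (#B * #C) := by
    refine le_of_mul_le_mul_right ?_ (mul_pos hε hX')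
    linarith
  linarith

/-- Markov's inequality over cells: one factor `ε` of `ε ^ 3` pays for the discarded cells, leaving
`ε ^ 2` for each retained one. -/
theorem isAlmostGoodPartition_of_minorityCount_le [DecidableEq α] {ε : ℝ} (hε : 0 < ε)
    {A B C : Finset α} (hB : B.Nonempty) (hC : C.Nonempty) (P : Finpartition A)
    (h : ∑ X ∈ P.parts, ∑ y ∈ B, ∑ z ∈ C, (minorityCount H.IsEdge X y z : ℝ) ≤
      ε ^ 3 * (#A * #B * #C)) : H.IsAlmostGoodPartition ε B C P := by
  set p : Finset α → Prop := fun X => ∑ y ∈ B, ∑ z ∈ C, (minorityCount H.IsEdge X y z : ℝ) ≤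
      ε ^ 2 * (#X * (#B * #C)) with hp
  have hBC : (0 : ℝ) < #B * #C := by
    exact_mod_cast Nat.mul_pos hB.card_pos hC.card_pos
  refine ⟨P.parts.filter p, filter_subset _ _, ?_, fun X hX => ?_⟩
  · have hcard : #((P.parts.filter p).biUnion id) = ∑ X ∈ P.parts.filter p, #X :=
      card_biUnion fun X hX Y hY hXY =>
        P.disjoint (mem_filter.1 hX).1 (mem_filter.1 hY).1 hXY
    have hsum : ∑ X ∈ P.parts.filter p, (#X : ℝ) + ∑ X ∈ P.parts.filter (fun X => ¬ p X),
        (#X : ℝ) = #A := by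
      rw [sum_filter_add_sum_filter_not]
      exact_mod_cast P.sum_card_parts
    have hbad : ∑ X ∈ P.parts.filter (fun X => ¬ p X), ε ^ 2 * (#X * (#B * #C) : ℝ) ≤
        ε ^ 3 * (#A * #B * #C) := by
      refine le_trans ?_ h
      refine (sum_le_sum fun X hX => (not_le.1 (mem_filter.1 hX).2).le).trans ?_
      exact sum_le_sum_of_subset_of_nonneg (filter_subset _ _) fun _ _ _ =>
        sum_nonneg fun _ _ => sum_nonneg fun _ _ => Nat.cast_nonneg _
    rw [← mul_sum, ← sum_mul] at hbad
    have h2 : ∑ X ∈ P.parts.filter (fun X => ¬ p X), (#X : ℝ) ≤ ε * #A := by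
      refine le_of_mul_le_mul_right ?_ (mul_pos (pow_pos hε 2) hBC)
      linarith
    rw [hcard, Nat.cast_sum]
    linarith
  · rw [mem_filter] at hX
    exact isAlmostGoodSet_of_minorityCount_le hε (P.nonempty_of_mem_parts hX.1) hX.2

/-! ### Homogeneous partitions -/

/-- The left side is the product of the two counts, that is, minimum times maximum. -/
theorem sum_sum_ite_mul_le {β γ δ : Type*} (f : β → γ → δ → Prop) (X : Finset β) (v : γ) (w : δ) :
    ∑ x ∈ X, ∑ x' ∈ X, (if f x v w then 1 else 0) * (if f x' v w then 0 else 1) ≤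
      #X * minorityCount f X v w := by
  have h1 : ∑ x ∈ X, (if f x v w then 1 else 0) = #(X.filter fun x => f x v w) := by
    rw [card_filter]
  have h2 : ∑ x ∈ X, (if f x v w then 0 else 1) = #(X.filter fun x => ¬ f x v w) := by
    rw [card_filter]
    exact sum_congr rfl fun x _ => by split_ifs <;> simp_all
  rw [← sum_mul_sum, h1, h2, minorityCount, ← min_mul_max, mul_comm]
  gcongr
  exact max_le (card_filter_le _ _) (card_filter_le _ _)

/-- In a box in which few pairs along each axis disagree, nearly all triples agree. -/
theorem card_filter_isEdge_mul_le (X Y Z : Finset α) :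
    #((X ×ˢ Y ×ˢ Z).filter fun p => H.IsEdge p.1 p.2.1 p.2.2) *
      #((X ×ˢ Y ×ˢ Z).filter fun p => ¬ H.IsEdge p.1 p.2.1 p.2.2) ≤
    #X * #Y * #Z * (∑ y ∈ Y, ∑ z ∈ Z, minorityCount H.IsEdge X y z +
      ∑ x ∈ X, ∑ z ∈ Z, minorityCount H.IsEdge Y x z +
      ∑ x ∈ X, ∑ y ∈ Y, minorityCount H.IsEdge Z x y) := by
  let g : α → α → α → ℕ := fun x y z => if H.IsEdge x y z then 1 else 0
  let g' : α → α → α → ℕ := fun x y z => if H.IsEdge x y z then 0 else 1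
  have hT : #((X ×ˢ Y ×ˢ Z).filter fun p => H.IsEdge p.1 p.2.1 p.2.2) =
      ∑ p ∈ X ×ˢ Y ×ˢ Z, g p.1 p.2.1 p.2.2 := by rw [card_filter]
  have hF : #((X ×ˢ Y ×ˢ Z).filter fun p => ¬ H.IsEdge p.1 p.2.1 p.2.2) =
      ∑ p ∈ X ×ˢ Y ×ˢ Z, g' p.1 p.2.1 p.2.2 := by
    rw [card_filter]
    exact sum_congr rfl fun p _ => by simp only [g']; split_ifs <;> simp_all
  -- On the path `(x,y,z)`, `(x',y,z)`, `(x',y',z)`, `(x',y',z')` from an edge to a non-edge, some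
  -- single step goes from an edge to a non-edge.
  have hpt : ∀ x y z x' y' z', g x y z * g' x' y' z' ≤
      g x y z * g' x' y z + g x' y z * g' x' y' z + g x' y' z * g' x' y' z' := by
    intro x y z x' y' z'
    simp only [g, g']
    split_ifs <;> simp
  have h1 : ∑ p ∈ X ×ˢ Y ×ˢ Z, ∑ p' ∈ X ×ˢ Y ×ˢ Z,
      g p.1 p.2.1 p.2.2 * g' p'.1 p.2.1 p.2.2 ≤
      #X * #Y * #Z * ∑ y ∈ Y, ∑ z ∈ Z, minorityCount H.IsEdge X y z := by
    simp only [sum_product, sum_const, smul_eq_mul]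
    calc _ = #Y * #Z * ∑ y ∈ Y, ∑ z ∈ Z, ∑ x ∈ X, ∑ x' ∈ X, g x y z * g' x' y z := by
          simp only [← mul_sum]
          rw [sum_comm, card_product]
          congr 1
          exact sum_congr rfl fun y _ => sum_comm
      _ ≤ #Y * #Z * ∑ y ∈ Y, ∑ z ∈ Z, #X * minorityCount H.IsEdge X y z := by
          gcongr
          exact sum_sum_ite_mul_le _ _ _ _
      _ = _ := by simp only [← mul_sum]; ring
  have h2 : ∑ p ∈ X ×ˢ Y ×ˢ Z, ∑ p' ∈ X ×ˢ Y ×ˢ Z,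
      g p'.1 p.2.1 p.2.2 * g' p'.1 p'.2.1 p.2.2 ≤
      #X * #Y * #Z * ∑ x ∈ X, ∑ z ∈ Z, minorityCount H.IsEdge Y x z := by
    simp only [sum_product, sum_const, smul_eq_mul]
    calc _ = #X * #Z * ∑ x ∈ X, ∑ z ∈ Z, ∑ y ∈ Y, ∑ y' ∈ Y, g x y z * g' x y' z := by
          simp only [← mul_sum]
          rw [mul_assoc]
          congr 2
          rw [sum_comm' (t' := Z) (s' := fun _ => Y) (by tauto), sum_comm (s := X)]
          refine sum_congr rfl fun z _ => ?_
          rw [sum_comm]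
      _ ≤ #X * #Z * ∑ x ∈ X, ∑ z ∈ Z, #Y * minorityCount H.IsEdge Y x z := by
          gcongr with x _ z _
          refine le_trans (le_of_eq ?_) (sum_sum_ite_mul_le H.IsEdge Y x z)
          simp only [g, g', isEdge_swap_left x]
      _ = _ := by simp only [← mul_sum]; ring
  have h3 : ∑ p ∈ X ×ˢ Y ×ˢ Z, ∑ p' ∈ X ×ˢ Y ×ˢ Z,
      g p'.1 p'.2.1 p.2.2 * g' p'.1 p'.2.1 p'.2.2 ≤
      #X * #Y * #Z * ∑ x ∈ X, ∑ y ∈ Y, minorityCount H.IsEdge Z x y := by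
    simp only [sum_product, sum_const, smul_eq_mul]
    calc _ = #X * #Y * ∑ x ∈ X, ∑ y ∈ Y, ∑ z ∈ Z, ∑ z' ∈ Z, g x y z * g' x y z' := by
          rw [mul_assoc]
          congr 2
          rw [sum_comm]
          refine sum_congr rfl fun x _ => ?_
          rw [sum_comm]
      _ ≤ #X * #Y * ∑ x ∈ X, ∑ y ∈ Y, #Z * minorityCount H.IsEdge Z x y := by
          gcongr with x _ y _
          refine le_trans (le_of_eq ?_) (sum_sum_ite_mul_le H.IsEdge Z x y)
          simp only [g, g', isEdge_rotate x]
      _ = _ := by simp only [← mul_sum]; ring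
  rw [hT, hF, sum_mul_sum, mul_add, mul_add]
  refine le_trans ?_ (add_le_add (add_le_add h1 h2) h3)
  simp only [← sum_add_distrib]
  exact sum_le_sum fun p _ => sum_le_sum fun p' _ => hpt _ _ _ _ _ _

theorem sum_parts_sum {M : Type*} [AddCommMonoid M] [DecidableEq α] {S : Finset α}
    (P : Finpartition S) (φ : α → M) : ∑ X ∈ P.parts, ∑ x ∈ X, φ x = ∑ x ∈ S, φ x := by
  conv_rhs => rw [← P.biUnion_parts]
  exact (sum_biUnion fun X hX Y hY hXY => P.disjoint hX hY hXY).symm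

/-- Each inhomogeneous box has minority counts totalling at least `τ / 2` times its volume. Over all
boxes the three axes give `3 * η * |S| ^ 3`, so the bad volume is at most `(6 * η / τ) * |S| ^ 3`.
-/
theorem isHomogeneousPartition_of_minorityCount_le [DecidableEq α] {τ η : ℝ} (hτ : 0 < τ)
    (hτ' : τ ≤ 1 / 2) (hη : 6 * η ≤ τ ^ 2) {S : Finset α} (P : Finpartition S)
    (h : ∑ X ∈ P.parts, ∑ y ∈ S, ∑ z ∈ S, (minorityCount H.IsEdge X y z : ℝ) ≤ η * #S ^ 3) :
    H.IsHomogeneousPartition τ P := by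
  unfold IsHomogeneousPartition
  set p : α × α × α → Prop := fun p => ∃ X ∈ P.parts, ∃ Y ∈ P.parts, ∃ Z ∈ P.parts,
      H.IsHomogeneousTriple τ X Y Z ∧ p.1 ∈ X ∧ p.2.1 ∈ Y ∧ p.2.2 ∈ Z with hp
  let R : Finset α × Finset α × Finset α → ℕ := fun q =>
    ∑ y ∈ q.2.1, ∑ z ∈ q.2.2, minorityCount H.IsEdge q.1 y z +
      ∑ x ∈ q.1, ∑ z ∈ q.2.2, minorityCount H.IsEdge q.2.1 x z +
      ∑ x ∈ q.1, ∑ y ∈ q.2.1, minorityCount H.IsEdge q.2.2 x y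
  let B := (P.parts ×ˢ P.parts ×ˢ P.parts).filter fun q =>
    ¬ H.IsHomogeneousTriple τ q.1 q.2.1 q.2.2
  have hR : ∑ q ∈ P.parts ×ˢ P.parts ×ˢ P.parts, (R q : ℝ) ≤ 3 * (η * #S ^ 3) := by
    refine le_trans (le_of_eq ?_) (mul_le_mul_of_nonneg_left h zero_le_three)
    rw [show (3 : ℝ) = ((3 : ℕ) : ℝ) by norm_num]
    norm_cast
    simp only [R, sum_product, sum_add_distrib]
    have e1 : ∑ X ∈ P.parts, ∑ Y ∈ P.parts, ∑ Z ∈ P.parts,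
        ∑ y ∈ Y, ∑ z ∈ Z, minorityCount H.IsEdge X y z =
        ∑ X ∈ P.parts, ∑ y ∈ S, ∑ z ∈ S, minorityCount H.IsEdge X y z := by
      refine sum_congr rfl fun X _ => ?_
      rw [← sum_parts_sum P]
      refine sum_congr rfl fun Y _ => ?_
      rw [sum_comm]
      exact sum_congr rfl fun y _ => sum_parts_sum P _
    have e2 : ∑ X ∈ P.parts, ∑ Y ∈ P.parts, ∑ Z ∈ P.parts,
        ∑ x ∈ X, ∑ z ∈ Z, minorityCount H.IsEdge Y x z =
        ∑ X ∈ P.parts, ∑ y ∈ S, ∑ z ∈ S, minorityCount H.IsEdge X y z := by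
      rw [sum_comm, ← e1]
    have e3 : ∑ X ∈ P.parts, ∑ Y ∈ P.parts, ∑ Z ∈ P.parts,
        ∑ x ∈ X, ∑ y ∈ Y, minorityCount H.IsEdge Z x y =
        ∑ X ∈ P.parts, ∑ y ∈ S, ∑ z ∈ S, minorityCount H.IsEdge X y z := by
      rw [← e1]
      conv_rhs => rw [sum_comm]; enter [2, X]; rw [sum_comm]
    rw [e1, e2, e3]
    ring
  have hbox : ∀ q ∈ B, τ / 2 * (#q.1 * (#q.2.1 * #q.2.2) : ℝ) ≤ R q := by
    rintro ⟨X, Y, Z⟩ hq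
    simp only [B, mem_filter, mem_product] at hq
    obtain ⟨⟨hX, hY, hZ⟩, hq⟩ := hq
    have hpos : 0 < #(X ×ˢ Y ×ˢ Z) := by
      rw [card_pos]
      exact (P.nonempty_of_mem_parts hX).product
        ((P.nonempty_of_mem_parts hY).product (P.nonempty_of_mem_parts hZ))
    have hsplit := card_filter_add_card_filter_not (s := X ×ˢ Y ×ˢ Z)
      fun p => H.IsEdge p.1 p.2.1 p.2.2
    have hnear := not_nearZeroOne_div hpos hsplit (ε := τ) (by
      rw [IsHomogeneousTriple, density] at hq
      rw [card_product, card_product]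
      push_cast
      rw [← mul_assoc]
      exact hq)
    have hmul := card_filter_isEdge_mul_le (H := H) X Y Z
    rw [mul_assoc (#X), ← card_product Y, ← card_product X] at hmul
    simp only [R]
    rw [← Nat.cast_mul, ← card_product Y, ← Nat.cast_mul, ← card_product X]
    set N := #(X ×ˢ Y ×ˢ Z)
    set a := #((X ×ˢ Y ×ˢ Z).filter fun p => H.IsEdge p.1 p.2.1 p.2.2)
    set b := #((X ×ˢ Y ×ˢ Z).filter fun p => ¬ H.IsEdge p.1 p.2.1 p.2.2)
    have hN : (0 : ℝ) < N := by exact_mod_cast hpos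
    have hab : (a : ℝ) + b = N := by exact_mod_cast hsplit
    have hmul' := (Nat.cast_le (α := ℝ)).2 hmul
    rw [Nat.cast_mul, Nat.cast_mul] at hmul'
    refine le_of_mul_le_mul_left (le_trans ?_ hmul') hN
    -- Expanding `(a - τN)(b - τN) ≥ 0` with `a + b = N` gives `ab ≥ τ(1 - τ)N²`.
    have h1 := mul_nonneg (sub_nonneg.2 hnear.1) (sub_nonneg.2 hnear.2)
    have h2 : τ / 2 ≤ τ * (1 - τ) := by nlinarith
    have h3 : τ / 2 * (N : ℝ) ^ 2 ≤ τ * (1 - τ) * (N : ℝ) ^ 2 := by gcongr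
    have h4 : τ * N * (a + b) = τ * (N : ℝ) ^ 2 := by rw [hab]; ring
    nlinarith
  have hcover : (S ×ˢ S ×ˢ S).filter (fun t => ¬ p t) ⊆
      B.biUnion fun q => q.1 ×ˢ q.2.1 ×ˢ q.2.2 := by
    rintro ⟨x, y, z⟩ ht
    simp only [mem_filter, mem_product] at ht
    obtain ⟨⟨hx, hy, hz⟩, ht⟩ := ht
    obtain ⟨X, hX, hxX⟩ := P.exists_mem hx
    obtain ⟨Y, hY, hyY⟩ := P.exists_mem hy
    obtain ⟨Z, hZ, hzZ⟩ := P.exists_mem hz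
    refine mem_biUnion.2 ⟨(X, Y, Z), ?_, by simp [hxX, hyY, hzZ]⟩
    simp only [B, mem_filter, mem_product]
    exact ⟨⟨hX, hY, hZ⟩, fun hom => ht ⟨X, hX, Y, hY, Z, hZ, hom, hxX, hyY, hzZ⟩⟩
  have hbad : (#((S ×ˢ S ×ˢ S).filter fun t => ¬ p t) : ℝ) ≤
      ∑ q ∈ B, (#q.1 * (#q.2.1 * #q.2.2) : ℝ) := by
    have := (card_le_card hcover).trans card_biUnion_le
    simp only [card_product] at this
    exact_mod_cast this
  have hsplit : (#((S ×ˢ S ×ˢ S).filter p) : ℝ) + #((S ×ˢ S ×ˢ S).filter fun t => ¬ p t) =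
      #S ^ 3 := by
    have := card_filter_add_card_filter_not (s := S ×ˢ S ×ˢ S) p
    rw [card_product, card_product] at this
    rw [← Nat.cast_add, this]
    push_cast
    ring
  have htot : τ / 2 * ∑ q ∈ B, (#q.1 * (#q.2.1 * #q.2.2) : ℝ) ≤ 3 * (η * #S ^ 3) := by
    rw [mul_sum]
    exact ((sum_le_sum hbox).trans (sum_le_sum_of_subset_of_nonneg (filter_subset _ _)
      fun _ _ _ => Nat.cast_nonneg _)).trans hR
  have hfin : (#((S ×ˢ S ×ˢ S).filter fun t => ¬ p t) : ℝ) ≤ τ * #S ^ 3 := by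
    refine le_of_mul_le_mul_left ?_ (half_pos hτ)
    have h5 : τ / 2 * (#((S ×ˢ S ×ˢ S).filter fun t => ¬ p t) : ℝ) ≤
      τ / 2 * ∑ q ∈ B, (#q.1 * (#q.2.1 * #q.2.2) : ℝ) := by gcongr
    have h6 : 6 * η * (#S : ℝ) ^ 3 ≤ τ ^ 2 * #S ^ 3 := by gcongr
    nlinarith
  linarith

end Hypergraph

/-! ### Tripartite bookkeeping and the choice of parameters -/

namespace Hypergraph

open Finset Classical

variable {α : Type*} {H : Hypergraph α}

theorem sum_union_le_add {ι : Type*} [DecidableEq ι] {f : ι → ℝ} (hf : ∀ i, 0 ≤ f i)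
    (s t : Finset ι) : ∑ i ∈ s ∪ t, f i ≤ ∑ i ∈ s, f i + ∑ i ∈ t, f i := by
  rw [← sum_union_inter]
  exact le_add_of_nonneg_right (sum_nonneg fun i _ => hf i)

section Tripartite

variable {U V W : Finset α}

theorem IsTripartite.swap_left (h : H.IsTripartite U V W) : H.IsTripartite V U W where
  vertexSet_eq := by rw [h.vertexSet_eq, Set.union_comm (V : Set α)]
  disjoint_left_mid := h.disjoint_left_mid.symm
  disjoint_left_right := h.disjoint_mid_right
  disjoint_mid_right := h.disjoint_left_right
  encard_inter_left_le := h.encard_inter_mid_le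
  encard_inter_mid_le := h.encard_inter_left_le
  encard_inter_right_le := h.encard_inter_right_le

theorem IsTripartite.swap_right (h : H.IsTripartite U V W) : H.IsTripartite U W V where
  vertexSet_eq := by rw [h.vertexSet_eq, Set.union_assoc, Set.union_assoc, Set.union_comm (V : Set α)]
  disjoint_left_mid := h.disjoint_left_right
  disjoint_left_right := h.disjoint_left_mid
  disjoint_mid_right := h.disjoint_mid_right.symm
  encard_inter_left_le := h.encard_inter_left_le
  encard_inter_mid_le := h.encard_inter_right_le
  encard_inter_right_le := h.encard_inter_mid_le

/-- Two vertices of an edge in the same part must coincide, leaving at most two elements. -/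
theorem IsUniform.not_isEdge_of_mem (hu : H.IsUniform 3) {A : Finset α}
    (hA : ∀ e ∈ E(H), (e ∩ (A : Set α)).encard ≤ 1) {x y z : α} (hx : x ∈ A) (hy : y ∈ A) :
    ¬ H.IsEdge x y z := by
  intro h
  have hxy : x = y := Set.encard_le_one_iff.1 (hA _ h) x y (by simp [hx]) (by simp [hy])
  have h3 := hu _ h
  rw [hxy, Set.insert_eq_of_mem (Set.mem_insert _ _)] at h3
  have h2 := Set.encard_insert_le {z} y
  rw [h3, Set.encard_singleton] at h2
  exact absurd h2 (by decide)

theorem minorityCount_eq_zero {X : Finset α} {y z : α} (h : ∀ x ∈ X, ¬ H.IsEdge x y z) :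
    minorityCount H.IsEdge X y z = 0 := by
  rw [minorityCount, filter_false_of_mem h]
  simp

theorem minorityCount_swap (X : Finset α) (y z : α) :
    minorityCount H.IsEdge X y z = minorityCount H.IsEdge X z y := by
  simp only [minorityCount, isEdge_swap_right _ y z]

/-- Only pairs in `V × W` and `W × V` can extend a vertex of `U` to an edge, and the two orders
contribute equally. -/
theorem IsTripartite.sum_minorityCount_eq [DecidableEq α] (h : H.IsTripartite U V W)
    (hu : H.IsUniform 3) {X : Finset α} (hX : X ⊆ U) :
    ∑ y ∈ U ∪ V ∪ W, ∑ z ∈ U ∪ V ∪ W, (minorityCount H.IsEdge X y z : ℝ) =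
      2 * ∑ y ∈ V, ∑ z ∈ W, (minorityCount H.IsEdge X y z : ℝ) := by
  have hd : Disjoint (U ∪ V) W := disjoint_union_left.2 ⟨h.disjoint_left_right, h.disjoint_mid_right⟩
  have hU : ∀ y ∈ U, ∀ z, (minorityCount H.IsEdge X y z : ℝ) = 0 := fun y hy z => by
    rw [minorityCount_eq_zero fun x hx => hu.not_isEdge_of_mem h.encard_inter_left_le (hX hx) hy,
      Nat.cast_zero]
  have hU' : ∀ z ∈ U, ∀ y, (minorityCount H.IsEdge X y z : ℝ) = 0 := fun z hz y => by
    rw [minorityCount_swap, hU z hz]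
  have hV : ∀ y ∈ V, ∀ z ∈ V, (minorityCount H.IsEdge X y z : ℝ) = 0 := fun y hy z hz => by
    rw [minorityCount_eq_zero, Nat.cast_zero]
    intro x _
    rw [isEdge_swap_left, isEdge_swap_right]
    exact hu.not_isEdge_of_mem h.encard_inter_mid_le hy hz
  have hW : ∀ y ∈ W, ∀ z ∈ W, (minorityCount H.IsEdge X y z : ℝ) = 0 := fun y hy z hz => by
    rw [minorityCount_eq_zero, Nat.cast_zero]
    intro x _
    rw [isEdge_swap_left, isEdge_swap_right]
    exact hu.not_isEdge_of_mem h.encard_inter_right_le hy hz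
  have hz : ∀ y, ∑ z ∈ U ∪ V ∪ W, (minorityCount H.IsEdge X y z : ℝ) =
      ∑ z ∈ V, (minorityCount H.IsEdge X y z : ℝ) +
        ∑ z ∈ W, (minorityCount H.IsEdge X y z : ℝ) := fun y => by
    rw [sum_union hd, sum_union h.disjoint_left_mid, sum_eq_zero fun z hz => hU' z hz y, zero_add]
  simp only [hz]
  rw [sum_union hd, sum_union h.disjoint_left_mid, sum_add_distrib, sum_add_distrib,
    sum_add_distrib, sum_eq_zero fun y hy => sum_eq_zero fun z _ => hU y hy z,
    sum_eq_zero fun y hy => sum_eq_zero fun z _ => hU y hy z,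
    sum_eq_zero fun y hy => sum_eq_zero fun z hz => hV y hy z hz,
    sum_eq_zero fun y hy => sum_eq_zero fun z hz => hW y hy z hz, sum_comm (s := W)]
  have hs : ∑ y ∈ V, ∑ z ∈ W, (minorityCount H.IsEdge X z y : ℝ) =
      ∑ y ∈ V, ∑ z ∈ W, (minorityCount H.IsEdge X y z : ℝ) :=
    sum_congr rfl fun y _ => sum_congr rfl fun z _ => by rw [minorityCount_swap]
  rw [hs]
  ring

theorem IsTripartite.exists_finpartition [DecidableEq α] (h : H.IsTripartite U V W) {k r q : ℕ}
    {ε₁ ε₂ : ℝ} (hvc : H.slicewiseVCDim < (k : ℕ∞)) (hk : 1 ≤ k) (hr : 4 * k ≤ r * ε₁)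
    (hq : 4 * k ≤ q * ε₂) (hrε : r ^ 2 * ε₂ ≤ ε₁) :
    ∃ P : Finpartition U, #P.parts ≤ 2 ^ (r ^ 2 * q ^ 2) ∧
      ∑ X ∈ P.parts, ∑ v ∈ V, ∑ w ∈ W, (minorityCount H.IsEdge X v w : ℝ) ≤
        2 * ε₁ * (#U * #V * #W) := by
  have hU : (U : Set α) ⊆ V(H) := by
    rw [h.vertexSet_eq]; exact fun x hx => Or.inl (Or.inl hx)
  have hV : (V : Set α) ⊆ V(H) := by
    rw [h.vertexSet_eq]; exact fun x hx => Or.inl (Or.inr hx)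
  have hW : (W : Set α) ⊆ V(H) := by
    rw [h.vertexSet_eq]; exact fun x hx => Or.inr hx
  refine exists_finpartition_minorityCount_le hk hr hq hrε (fun w hw A hA => ?_) fun v hv B hB => ?_
  · exact card_image_traceOn_le hvc h.disjoint_left_mid hU hV (hW hw) hA
  · have : (fun u w v => H.IsEdge u v w) = H.IsEdge := by
      funext u w v
      exact propext (isEdge_swap_right _ _ _)
    rw [this]
    exact card_image_traceOn_le hvc h.disjoint_left_right hU hW (hV hv) hB

/-- The partition of the union of three disjoint sets obtained from partitions of each of them. -/
def unionPartition [DecidableEq α] (hUV : Disjoint U V) (hUW : Disjoint U W) (hVW : Disjoint V W)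
    (PU : Finpartition U) (PV : Finpartition V) (PW : Finpartition W) :
    Finpartition (U ∪ V ∪ W) :=
  Finpartition.ofExistsUnique (PU.parts ∪ PV.parts ∪ PW.parts)
    (by
      intro p hp
      simp only [mem_union] at hp
      rcases hp with (hp | hp) | hp
      · exact (PU.subset hp).trans (subset_union_left.trans subset_union_left)
      · exact (PV.subset hp).trans (subset_union_right.trans subset_union_left)
      · exact (PW.subset hp).trans subset_union_right)
    (by
      intro a ha
      have key : ∀ {A B C : Finset α} (PA : Finpartition A) (PB : Finpartition B)
          (PC : Finpartition C), Disjoint A B → Disjoint A C → a ∈ A →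
          ∃! t, (t ∈ PA.parts ∨ t ∈ PB.parts ∨ t ∈ PC.parts) ∧ a ∈ t := by
        intro A B C PA PB PC hAB hAC haA
        obtain ⟨t, ⟨ht, hat⟩, huniq⟩ := PA.existsUnique_mem haA
        refine ⟨t, ⟨Or.inl ht, hat⟩, ?_⟩
        rintro s ⟨hs | hs | hs, has⟩
        · exact huniq s ⟨hs, has⟩
        · exact absurd (PB.subset hs has) (disjoint_left.1 hAB haA)
        · exact absurd (PC.subset hs has) (disjoint_left.1 hAC haA)
      simp only [mem_union] at ha
      rcases ha with (ha | ha) | ha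
      · convert key PU PV PW hUV hUW ha using 3
        simp only [mem_union]
        tauto
      · convert key PV PU PW hUV.symm hVW ha using 3
        simp only [mem_union]
        tauto
      · convert key PW PU PV hUW.symm hVW.symm ha using 3
        simp only [mem_union]
        tauto)
    (by simp [PU.empty_notMem_parts, PV.empty_notMem_parts, PW.empty_notMem_parts])

end Tripartite

/-- The parameters of the construction, and the resulting bound on the number of parts. -/
theorem exists_parameters {k : ℕ} (hk : 1 ≤ k) {τ : ℝ} (hτ : 0 < τ) (hτk : τ < 1 / (200000 * k)) :
    ∃ (r q : ℕ) (ε₂ : ℝ), 4 * (k : ℝ) ≤ r * ((τ ^ 64 / 28) ^ 3 / 2) ∧ 4 * (k : ℝ) ≤ q * ε₂ ∧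
      r ^ 2 * ε₂ ≤ (τ ^ 64 / 28) ^ 3 / 2 ∧
      ((3 * 2 ^ (r ^ 2 * q ^ 2) : ℕ) : ℝ) ≤ (2 : ℝ) ^ ((2 : ℝ) ^ (τ ^ (-(1545 : ℝ)))) := by
  have hk' : (1 : ℝ) ≤ k := by exact_mod_cast hk
  obtain ⟨x, hx⟩ : ∃ x : ℝ, x = τ⁻¹ := ⟨_, rfl⟩
  have hτx : τ = x⁻¹ := by rw [hx, inv_inv]
  have hxk : 200000 * (k : ℝ) < x := by
    rw [hx, lt_inv_comm₀ (by positivity) hτ]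
    simpa using hτk
  have hx0 : 0 < x := by linarith
  have hx1 : 1 ≤ x := by linarith
  set ε₁ : ℝ := (τ ^ 64 / 28) ^ 3 / 2 with hε₁
  have hε₁pos : 0 < ε₁ := by positivity
  have hε₁x : ε₁⁻¹ = 43904 * x ^ 192 := by
    rw [hε₁, hτx]
    field_simp
    norm_num
  obtain ⟨r, hr⟩ : ∃ r : ℕ, r = ⌈4 * k * ε₁⁻¹⌉₊ := ⟨_, rfl⟩
  have hr1 : 4 * k * ε₁⁻¹ ≤ (r : ℝ) := hr ▸ Nat.le_ceil _
  have hr2 : (r : ℝ) < 4 * k * ε₁⁻¹ + 1 := hr ▸ Nat.ceil_lt_add_one (by positivity)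
  have hr0 : (0 : ℝ) < r := lt_of_lt_of_le (by positivity) hr1
  have hx192 : 1 ≤ x ^ 192 := one_le_pow₀ hx1
  -- Here `43904 = 2 * 28 ^ 3`, and one spare factor `x > 200000 * k` absorbs `175616 * k + 1`.
  have hrx : (r : ℝ) ≤ x ^ 193 := by
    rw [hε₁x] at hr2
    calc (r : ℝ) ≤ 4 * k * (43904 * x ^ 192) + x ^ 192 := by linarith
      _ = (175616 * k + 1) * x ^ 192 := by ring
      _ ≤ x * x ^ 192 := by gcongr; linarith
      _ = x ^ 193 := by ring
  obtain ⟨q, hq⟩ : ∃ q : ℕ, q = ⌈4 * k * (ε₁⁻¹ * r ^ 2)⌉₊ := ⟨_, rfl⟩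
  have hq1 : 4 * k * (ε₁⁻¹ * r ^ 2) ≤ (q : ℝ) := hq ▸ Nat.le_ceil _
  have hq2 : (q : ℝ) < 4 * k * (ε₁⁻¹ * r ^ 2) + 1 := hq ▸ Nat.ceil_lt_add_one (by positivity)
  have hqx : (q : ℝ) ≤ x ^ 579 := by
    rw [hε₁x] at hq2
    have h1 : 1 ≤ x ^ 578 := one_le_pow₀ hx1
    calc (q : ℝ) ≤ 4 * k * (43904 * x ^ 192 * (x ^ 193) ^ 2) + x ^ 578 := by
          refine hq2.le.trans ?_
          gcongr
      _ = (175616 * k + 1) * x ^ 578 := by ring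
      _ ≤ x * x ^ 578 := by gcongr; linarith
      _ = x ^ 579 := by ring
  refine ⟨r, q, ε₁ / r ^ 2, ?_, ?_, ?_, ?_⟩
  · rwa [← div_eq_mul_inv, div_le_iff₀ hε₁pos] at hr1
  · calc 4 * (k : ℝ) = 4 * k * (ε₁⁻¹ * r ^ 2) * (ε₁ / r ^ 2) := by field_simp
      _ ≤ q * (ε₁ / r ^ 2) := by gcongr
  · exact le_of_eq (by field_simp)
  -- The exponent is `2 * 193 + 2 * 579 + 1 = 1545`. The number of parts is thus at most a single
  -- exponential `2 ^ (x ^ 1545)`; the second exponential comes only from `y ≤ 2 ^ y`.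
  · have hexp : ((r ^ 2 * q ^ 2 + 2 : ℕ) : ℝ) ≤ x ^ 1545 := by
      push_cast
      have h1 : 1 ≤ x ^ 1544 := one_le_pow₀ hx1
      calc (r : ℝ) ^ 2 * q ^ 2 + 2 ≤ (x ^ 193) ^ 2 * (x ^ 579) ^ 2 + 2 * x ^ 1544 := by
            gcongr
            linarith
        _ = 3 * x ^ 1544 := by ring
        _ ≤ x * x ^ 1544 := by gcongr; linarith
        _ = x ^ 1545 := by ring
    have hτpow : τ ^ (-(1545 : ℝ)) = x ^ 1545 := by
      rw [Real.rpow_neg hτ.le, hx, inv_pow]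
      norm_cast
    rw [hτpow]
    calc ((3 * 2 ^ (r ^ 2 * q ^ 2) : ℕ) : ℝ) ≤ ((2 ^ (r ^ 2 * q ^ 2 + 2) : ℕ) : ℝ) := by
          refine Nat.cast_le.2 ?_
          rw [pow_add]
          omega
      _ = (2 : ℝ) ^ ((r ^ 2 * q ^ 2 + 2 : ℕ) : ℝ) := by rw [Real.rpow_natCast]; push_cast; rfl
      _ ≤ _ := by
        refine Real.rpow_le_rpow_of_exponent_le one_le_two (hexp.trans ?_)
        obtain ⟨y, hy⟩ : ∃ y, y = x ^ 1545 := ⟨_, rfl⟩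
        have hy1 : 1 ≤ y := hy ▸ one_le_pow₀ hx1
        have := one_add_mul_self_le_rpow_one_add (s := 1) (by norm_num) hy1
        rw [← hy]
        norm_num at this
        linarith

end Hypergraph

/-! ### Assembling the three partitions -/

open Finset in
theorem theorem4p1 :
    ∀ k : ℕ, 1 ≤ k → ∃ K : ℝ, 0 < K ∧ ∃ ε₀ : ℝ, 0 < ε₀ ∧ ∀ τ : ℝ, 0 < τ → τ < ε₀ →
      ∃ n₀ : ℕ, ∀ (α : Type*) [DecidableEq α] (H : Hypergraph α) (U V W : Finset α),
        H.IsUniform 3 → H.IsTripartite U V W → U.card = V.card → V.card = W.card →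
        n₀ ≤ (U ∪ V ∪ W).card → H.slicewiseVCDim < (k : ℕ∞) →
        ∃ (P : Finpartition (U ∪ V ∪ W))
          (PU : Finpartition U) (PV : Finpartition V) (PW : Finpartition W),
          H.IsHomogeneousPartition τ P ∧
          (P.parts.card : ℝ) ≤ (2 : ℝ) ^ ((2 : ℝ) ^ (τ ^ (-K))) ∧
          P.parts = PU.parts ∪ PV.parts ∪ PW.parts ∧
          H.IsAlmostGoodPartition (τ ^ 64 / 28) V W PU ∧
          H.IsAlmostGoodPartition (τ ^ 64 / 28) U W PV ∧
          H.IsAlmostGoodPartition (τ ^ 64 / 28) U V PW := by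
  intro k hk
  have hk' : (1 : ℝ) ≤ k := by exact_mod_cast hk
  -- The threshold `1` only serves to make the three parts nonempty.
  refine ⟨1545, by norm_num, 1 / (200000 * k), by positivity, fun τ hτ hτk => ⟨1, ?_⟩⟩
  intro α _ H U V W hu ht hUV hVW hn hvc
  obtain ⟨r, q, ε₂, hr, hq, hrε, hsize⟩ := Hypergraph.exists_parameters hk hτ hτk
  have hτ1 : τ ≤ 1 / 2 := by
    refine hτk.le.trans ?_
    gcongr
    linarith
  obtain ⟨PU, hPU, hU⟩ := ht.exists_finpartition hvc hk hr hq hrε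
  obtain ⟨PV, hPV, hV⟩ := ht.swap_left.exists_finpartition hvc hk hr hq hrε
  obtain ⟨PW, hPW, hW⟩ := ht.swap_right.swap_left.exists_finpartition hvc hk hr hq hrε
  rw [mul_div_cancel₀ _ two_ne_zero] at hU hV hW
  have hε : 0 < τ ^ 64 / 28 := by positivity
  have hcard : #(U ∪ V ∪ W) = 3 * #U := by
    rw [card_union_of_disjoint (disjoint_union_left.2 ⟨ht.disjoint_left_right, ht.disjoint_mid_right⟩),
      card_union_of_disjoint ht.disjoint_left_mid]
    omega
  have hUne : U.Nonempty := card_pos.1 (by omega)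
  have hVne : V.Nonempty := card_pos.1 (by omega)
  have hWne : W.Nonempty := card_pos.1 (by omega)
  refine ⟨Hypergraph.unionPartition ht.disjoint_left_mid ht.disjoint_left_right
    ht.disjoint_mid_right PU PV PW, PU, PV, PW, ?_, ?_, rfl,
    Hypergraph.isAlmostGoodPartition_of_minorityCount_le hε hVne hWne PU hU,
    Hypergraph.isAlmostGoodPartition_of_minorityCount_le hε hUne hWne PV hV,
    Hypergraph.isAlmostGoodPartition_of_minorityCount_le hε hUne hVne PW hW⟩
  -- Each of the three parts contributes `2 * (τ ^ 64 / 28) ^ 3 * |U| ^ 3`, the `2` from ordered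
  -- pairs; the `27` is `|V(H)| ^ 3 / |U| ^ 3`.
  · have hη : 6 * (6 * (τ ^ 64 / 28) ^ 3 / 27) ≤ τ ^ 2 := by
      have h1 : τ ^ 64 ≤ τ := pow_le_of_le_one hτ.le (by linarith) (by norm_num)
      have h2 : (τ ^ 64 / 28) ^ 3 ≤ (τ / 28) ^ 3 := by gcongr
      have h3 : τ ^ 3 ≤ τ ^ 2 := pow_le_pow_of_le_one hτ.le (by linarith) (by norm_num)
      have h4 : 0 ≤ τ ^ 3 := by positivity
      rw [div_pow τ] at h2
      linarith
    refine Hypergraph.isHomogeneousPartition_of_minorityCount_le hτ hτ1 hη _ ?_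
    change ∑ X ∈ PU.parts ∪ PV.parts ∪ PW.parts, _ ≤ _
    have hnonneg : ∀ X : Finset α, 0 ≤ ∑ y ∈ U ∪ V ∪ W, ∑ z ∈ U ∪ V ∪ W,
        (minorityCount H.IsEdge X y z : ℝ) := fun X =>
      sum_nonneg fun _ _ => sum_nonneg fun _ _ => Nat.cast_nonneg _
    refine (Hypergraph.sum_union_le_add hnonneg _ _).trans
      ((add_le_add_left (Hypergraph.sum_union_le_add hnonneg _ _) _).trans ?_)
    have eU := fun X hX => ht.sum_minorityCount_eq hu (PU.subset (ha := hX) (a := X))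
    have eV := fun X hX => ht.swap_left.sum_minorityCount_eq hu (PV.subset (ha := hX) (a := X))
    have eW := fun X hX =>
      ht.swap_right.swap_left.sum_minorityCount_eq hu (PW.subset (ha := hX) (a := X))
    rw [union_comm V U] at eV
    rw [union_assoc W U V, union_comm W (U ∪ V)] at eW
    rw [sum_congr rfl eU, sum_congr rfl eV, sum_congr rfl eW,
      ← mul_sum, ← mul_sum, ← mul_sum, hcard]
    rw [← hVW, ← hUV] at hU hV hW
    push_cast
    linarith
  · refine le_trans (Nat.cast_le.2 ?_) hsize
    change #(PU.parts ∪ PV.parts ∪ PW.parts) ≤ _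
    have h1 := card_union_le (PU.parts ∪ PV.parts) PW.parts
    have h2 := card_union_le PU.parts PV.parts
    omega
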